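/- Let $t\ge 1$, let $0<r_0\le r_1\le\cdots\le r_{t-1}$ be integers, and let $I\subseteq\{0,\dots,t-1\}$ be such that whenever $r_i=r_{i+1}$ and $i+1\in I$, also $i\in I$. Write $\overline I=\{0,\dots,t-1\}\setminus I$ and $U_i=\mathbb{C}^{r_0+\cdots+r_{i-1}}$ for $0\le i\le t$ (so $U_0=0$). Let $\Lambda_{(r_i),I}$ be the affine variety (with its reduced structure) of all tuples $(u_i,A_i,B_i)$ consisting of vectors $u_i\in U_i$ $(0\le i\le t)$ and linear maps $A_i:U_i\to U_{i+1}$, $B_i:U_{i+1}\to U_i$ $(0\le i\le t-1)$ such that $$B_iA_i=A_{i-1}B_{i-1}\ (1\le i\le t-1),\qquad B_iu_{i+1}=u_i\ (i\in I),\qquad A_iu_i=u_{i+1}\ (i\in\overline I).$$ Let $\Lambda^\circ\subseteq\Lambda_{(r_i),I}$ be the subset of those points such that - for every $j\in I$, either ($A_j$ is injective and $u_{j+1}\notin\operatorname{im}A_j$) or $B_j$ is surjective; - for every $j\in\overline I$, either $A_j$ is injective or $B_j$ is surjective. Put $$d_{(r_i),I}=2\sum_{i=0}^{t-1}(\dim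 U_i)(\dim U_{i+1})-\sum_{i=1}^{t-1}(\dim U_i)^2+\sum_{i=0}^{t}\dim U_i-\sum_{i\in I}\dim U_i-\sum_{i\in\overline I}\dim U_{i+1}.$$ Then $\Lambda^\circ$ is a nonempty Zariski-open subset of $\Lambda_{(r_i),I}$, and it is nonsingular of dimension $d_{(r_i),I}$: at every point of $\Lambda^\circ$ the local ring of $\Lambda_{(r_i),I}$ is a regular local ring of Krull dimension $d_{(r_i),I}$ (in particular $d_{(r_i),I}\ge 0$). -/

import Mathlib

noncomputable section

/-! ### Affine varieties over `ℂ`: Zariski-open subsets and local rings -/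

namespace AffineVariety

variable {σ : Type}

/-- `O` is a Zariski-open subset of `Z ⊆ ℂ^σ`: the complement in `Z` of the zero locus of some
ideal of polynomials. -/
def IsZariskiOpenIn (Z O : Set (σ → ℂ)) : Prop :=
  ∃ J : Ideal (MvPolynomial σ ℂ), O = Z \ MvPolynomial.zeroLocus ℂ J

/-- The coordinate ring `ℂ[Z]`: polynomials modulo all those vanishing on `Z`
(so `Z` carries its reduced structure). -/
abbrev CoordRing (Z : Set (σ → ℂ)) : Type :=
  MvPolynomial σ ℂ ⧸ MvPolynomial.vanishingIdeal ℂ Z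

/-- Evaluation of regular functions on `Z` at a point `p` of `Z`. -/
def evalAt (Z : Set (σ → ℂ)) (p : Z) : CoordRing Z →+* ℂ :=
  Ideal.Quotient.lift (MvPolynomial.vanishingIdeal ℂ Z)
    (MvPolynomial.aeval (R := ℂ) p.1).toRingHom (fun _ hf => hf p.1 p.2)

/-- The ideal of the regular functions on `Z` that vanish at `p`. -/
def idealAt (Z : Set (σ → ℂ)) (p : Z) : Ideal (CoordRing Z) :=
  RingHom.ker (evalAt Z p)

instance idealAt_isPrime (Z : Set (σ → ℂ)) (p : Z) : (idealAt Z p).IsPrime :=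
  RingHom.ker_isPrime (evalAt Z p)

/-- The local ring `𝒪_{Z,p}` of `Z` at the point `p`. -/
abbrev LocalRingAt (Z : Set (σ → ℂ)) (p : Z) : Type :=
  Localization.AtPrime (idealAt Z p)

end AffineVariety

/-! ### Enhanced quiver varieties of type `A` -/

namespace EnhancedQuiver

variable {t : ℕ}

/-- `dim U_i = r_0 + ⋯ + r_{i-1}`. -/
def dimU (r : Fin t → ℕ) (i : ℕ) : ℕ :=
  ∑ k ∈ Finset.univ.filter (fun k : Fin t => (k : ℕ) < i), r k

/-- The coordinates on
`∏_{i=0}^t U_i × ∏_{i=0}^{t-1} (Hom(U_i, U_{i+1}) × Hom(U_{i+1}, U_i))`, where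
`U_i = ℂ^{dim U_i}`: the entries of the vectors `u_i`, of the matrices `A_i`, and of the
matrices `B_i`. -/
abbrev Coord (r : Fin t → ℕ) : Type :=
  (Σ i : Fin (t + 1), Fin (dimU r i)) ⊕
    ((Σ i : Fin t, Fin (dimU r (i + 1)) × Fin (dimU r i)) ⊕
      (Σ i : Fin t, Fin (dimU r i) × Fin (dimU r (i + 1))))

/-- The vector `u_i ∈ U_i` of a tuple `x = (u_i, A_i, B_i)`, for `0 ≤ i ≤ t`. -/
def vecU {r : Fin t → ℕ} (x : Coord r → ℂ) (i : ℕ) (hi : i < t + 1) :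
    Fin (dimU r i) → ℂ :=
  fun a => x (Sum.inl ⟨⟨i, hi⟩, a⟩)

/-- The matrix of `A_i : U_i → U_{i+1}` of a tuple `x = (u_i, A_i, B_i)`, for `0 ≤ i < t`. -/
def matA {r : Fin t → ℕ} (x : Coord r → ℂ) (i : ℕ) (hi : i < t) :
    Matrix (Fin (dimU r (i + 1))) (Fin (dimU r i)) ℂ :=
  Matrix.of fun a b => x (Sum.inr (Sum.inl ⟨⟨i, hi⟩, (a, b)⟩))

/-- The matrix of `B_i : U_{i+1} → U_i` of a tuple `x = (u_i, A_i, B_i)`, for `0 ≤ i < t`. -/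
def matB {r : Fin t → ℕ} (x : Coord r → ℂ) (i : ℕ) (hi : i < t) :
    Matrix (Fin (dimU r i)) (Fin (dimU r (i + 1))) ℂ :=
  Matrix.of fun a b => x (Sum.inr (Sum.inr ⟨⟨i, hi⟩, (a, b)⟩))

/-- The enhanced quiver variety `Λ_{(r_i),I}`: the tuples `(u_i, A_i, B_i)` such that
`B_i A_i = A_{i-1} B_{i-1}` for `1 ≤ i ≤ t - 1`, `B_i u_{i+1} = u_i` for `i ∈ I`, and
`A_i u_i = u_{i+1}` for `i ∉ I`. -/
def enhancedVariety (r : Fin t → ℕ) (I : Finset (Fin t)) : Set (Coord r → ℂ) :=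
  {x | (∀ (i : ℕ) (hi : i + 1 < t),
          matB x (i + 1) hi * matA x (i + 1) hi
            = matA x i (Nat.lt_of_succ_lt hi) * matB x i (Nat.lt_of_succ_lt hi)) ∧
       (∀ i ∈ I, (matB x i i.2).mulVec (vecU x (i + 1) (Nat.succ_lt_succ i.2))
            = vecU x i (Nat.lt_succ_of_lt i.2)) ∧
       (∀ i ∉ I, (matA x i i.2).mulVec (vecU x i (Nat.lt_succ_of_lt i.2))
            = vecU x (i + 1) (Nat.succ_lt_succ i.2))}

/-- The subset `Λ°` of `Λ_{(r_i),I}`: for every `j ∈ I`, either `A_j` is injective and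
`u_{j+1} ∉ im A_j`, or `B_j` is surjective; for every `j ∉ I`, either `A_j` is injective or
`B_j` is surjective. -/
def enhancedVarietyCirc (r : Fin t → ℕ) (I : Finset (Fin t)) : Set (Coord r → ℂ) :=
  {x | x ∈ enhancedVariety r I ∧
       (∀ j ∈ I,
          (Function.Injective (matA x j j.2).mulVec ∧
            vecU x (j + 1) (Nat.succ_lt_succ j.2) ∉ Set.range (matA x j j.2).mulVec) ∨
          Function.Surjective (matB x j j.2).mulVec) ∧
       (∀ j ∉ I,
          Function.Injective (matA x j j.2).mulVec ∨
          Function.Surjective (matB x j j.2).mulVec)}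

/-- The naively expected dimension `d_{(r_i),I}` of `Λ_{(r_i),I}`: the number of coordinates
minus the number of equations. -/
def expectedDim (r : Fin t → ℕ) (I : Finset (Fin t)) : ℤ :=
  2 * ∑ i ∈ Finset.range t, (dimU r i : ℤ) * (dimU r (i + 1) : ℤ)
    - ∑ i ∈ Finset.Ico 1 t, (dimU r i : ℤ) ^ 2
    + ∑ i ∈ Finset.range (t + 1), (dimU r i : ℤ)
    - ∑ i ∈ I, (dimU r i : ℤ)
    - ∑ i ∈ Iᶜ, (dimU r (i + 1) : ℤ)

end EnhancedQuiver

end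

/-!
The equations of `Λ` are as many as the expected codimension, so everything follows from the
Jacobian criterion once their differentials are shown to be linearly independent at each point of
`Λ°`.

For this, order the equations by level: those of level `j` are `B_j A_j = A_{j-1} B_{j-1}` and the
equation between `u_j` and `u_{j+1}`. The variables `A_j`, `B_j`, `u_{j+1}` do not occur in the
equations of level less than `j`, and the condition at `j` in the definition of `Λ°` says precisely
what is needed for the differential of the equations of level `j` to be surjective already on these
variables (`exists_level_preimage`): one solves with a right inverse of `B_j`, or with a left inverse
of `A_j`, respectively of `A_j` with the column `u_{j+1}` appended. So the Jacobian matrix is block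
triangular with independent diagonal blocks (`linearIndependent_differentials`).

The Jacobian criterion (`isRegularLocalRing_localRingAt`) compares two bounds for `m` equations in
`n` variables. By Krull's height theorem and the Nullstellensatz the local ring has dimension at
least `n - m` (`card_le_height_idealAt_add`); by Nakayama's lemma, independence of the differentials
lets its maximal ideal be generated by `n - m` elements (`spanFinrank_maximalIdeal_add_card_le`). The
second argument only uses that the equations vanish on `Λ`, so it applies directly to the reduced
structure.

`Λ°` is open because the existence of a one-sided inverse is detected by the nonvanishing of a
determinant, and it contains the points with all `u_i` and `A_i` zero and all `B_i` surjective.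
-/

noncomputable section

open MvPolynomial

namespace AffineVariety

/-! ### The Jacobian criterion at a point -/

section Jacobian

variable {σ : Type}

/-- The maximal ideal of the point `p` in the polynomial ring: the kernel of evaluation at `p`. -/
abbrev maxIdeal (p : σ → ℂ) : Ideal (MvPolynomial σ ℂ) := RingHom.ker (eval p)

theorem maxIdeal_isMaximal (p : σ → ℂ) : (maxIdeal p).IsMaximal :=
  RingHom.ker_isMaximal_of_surjective _ fun z => ⟨C z, by simp⟩

/-- Translations of affine space permute the points transitively, and one of the maximal ideals
has height `dim ℂ[σ]`; by the Nullstellensatz it belongs to a point. -/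
theorem height_maxIdeal [Finite σ] (p : σ → ℂ) : (maxIdeal p).height = Nat.card σ := by
  have hdim : ringKrullDim (MvPolynomial σ ℂ) = Nat.card σ := by
    simp [MvPolynomial.ringKrullDim_of_isNoetherianRing]
  have : FiniteRingKrullDim (MvPolynomial σ ℂ) := by
    rw [finiteRingKrullDim_iff_ne_bot_and_top, hdim]
    refine ⟨by simp, fun h => ENat.natCast_ne_top (Nat.card σ) (WithBot.coe_injective ?_)⟩
    exact h
  obtain ⟨M, hM, hMh⟩ := Ideal.exists_isMaximal_height (R := MvPolynomial σ ℂ)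
  obtain ⟨x, rfl⟩ := isMaximal_iff_eq_vanishingIdeal_singleton.mp hM
  let τ (v : σ → ℂ) : MvPolynomial σ ℂ →ₐ[ℂ] MvPolynomial σ ℂ := aeval fun i => X i + C (v i)
  have hτ (v : σ → ℂ) : (τ v).comp (τ (-v)) = AlgHom.id ℂ _ := by
    ext i; simp [τ]
  let e : MvPolynomial σ ℂ ≃ₐ[ℂ] MvPolynomial σ ℂ :=
    AlgEquiv.ofAlgHom (τ (p - x)) (τ (x - p)) (by simpa using hτ (p - x)) (by simpa using hτ (x - p))
  have he :
      (vanishingIdeal ℂ {x}).comap (e : MvPolynomial σ ℂ ≃+* MvPolynomial σ ℂ) = maxIdeal p := by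
    ext f
    have : (aeval x).comp (τ (p - x)) = (aeval p : MvPolynomial σ ℂ →ₐ[ℂ] ℂ) := by
      ext i; simp [τ]
    have h := DFunLike.congr_fun this f
    rw [Ideal.mem_comap, mem_vanishingIdeal_singleton_iff, RingHom.mem_ker]
    exact Eq.congr_left h
  rw [hdim] at hMh
  rw [← he, RingEquiv.height_comap]
  exact WithBot.coe_injective hMh

/-- The derivative `∑ vᵢ ∂ᵢ f(p)` of `f` at `p` in the direction `v`, as a linear form in `f`. -/
def dirDeriv [Fintype σ] (p v : σ → ℂ) : MvPolynomial σ ℂ →ₗ[ℂ] ℂ :=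
  ∑ i, v i • ((aeval p).toLinearMap ∘ₗ (pderiv i).toLinearMap)

theorem dirDeriv_apply [Fintype σ] (p v : σ → ℂ) (f : MvPolynomial σ ℂ) :
    dirDeriv p v f = ∑ i, v i * eval p (pderiv i f) := by
  simp [dirDeriv]

@[simp]
theorem dirDeriv_X [Fintype σ] (p v : σ → ℂ) (i : σ) : dirDeriv p v (X i) = v i := by
  classical
  simp [dirDeriv_apply, pderiv_X, Pi.single_apply, apply_ite]

@[simp]
theorem dirDeriv_mul [Fintype σ] (p v : σ → ℂ) (f g : MvPolynomial σ ℂ) :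
    dirDeriv p v (f * g) = dirDeriv p v f * eval p g + eval p f * dirDeriv p v g := by
  simp only [dirDeriv_apply, Finset.sum_mul, Finset.mul_sum, ← Finset.sum_add_distrib]
  refine Finset.sum_congr rfl fun i _ => ?_
  simp
  ring

/-- The affine linear form `∑ vᵢ (xᵢ - pᵢ)`. -/
def linForm [Fintype σ] (p : σ → ℂ) : (σ → ℂ) →ₗ[ℂ] MvPolynomial σ ℂ :=
  ∑ i, (LinearMap.proj i : (σ → ℂ) →ₗ[ℂ] ℂ).smulRight (X i - C (p i))

theorem linForm_apply [Fintype σ] (p v : σ → ℂ) :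
    linForm p v = ∑ i, C (v i) * (X i - C (p i)) := by
  simp [linForm, smul_eq_C_mul]

theorem linForm_mem [Fintype σ] (p v : σ → ℂ) : linForm p v ∈ maxIdeal p := by
  simp [linForm_apply, RingHom.mem_ker]

/-- First-order Taylor expansion at `p`. -/
theorem taylor_mem [Fintype σ] (p : σ → ℂ) (f : MvPolynomial σ ℂ) :
    f - C (eval p f) - linForm p (fun i => eval p (pderiv i f)) ∈ maxIdeal p ^ 2 := by
  classical
  induction f using MvPolynomial.induction_on with
  | C a => simp [linForm_apply]
  | add f g hf hg =>
    convert add_mem hf hg using 1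
    simp only [linForm_apply, map_add, add_mul, Finset.sum_add_distrib]
    ring
  | mul_X f j hf =>
    have hS := linForm_mem p (fun i => eval p (pderiv i f))
    have hX : X j - C (p j) ∈ maxIdeal p := by simp [RingHom.mem_ker]
    convert add_mem (Ideal.mul_mem_left _ (X j) hf)
      (pow_two (maxIdeal p) ▸ Ideal.mul_mem_mul hX hS) using 1
    have : linForm p (fun i => eval p (pderiv i (f * X j))) =
        C (p j) * linForm p (fun i => eval p (pderiv i f)) + C (eval p f) * (X j - C (p j)) := by
      simp only [linForm_apply, pderiv_mul, pderiv_X, map_add, map_mul, eval_X, add_mul,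
        Finset.sum_add_distrib, Finset.mul_sum]
      congr 1
      · exact Finset.sum_congr rfl fun i _ => by ring
      · rw [Finset.sum_eq_single j] <;> simp +contextual [eq_comm]
    rw [this]
    simp only [map_mul, eval_X]
    ring

/-- If `m` equations with linearly independent differentials at `p` hold in a local ring whose
maximal ideal comes from that of `p`, then this maximal ideal needs at most `dim - m` generators:
a complement of the span of the differentials generates it modulo its square, and Nakayama's lemma
applies. -/
theorem spanFinrank_maximalIdeal_add_card_le [Fintype σ] {ι : Type*} [Fintype ι] {p : σ → ℂ}
    {F : ι → MvPolynomial σ ℂ}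
    (hF : LinearIndependent ℂ fun k i => eval p (pderiv i (F k))) (hFp : ∀ k, eval p (F k) = 0)
    {L : Type*} [CommRing L] [IsLocalRing L] [IsNoetherianRing L] (g : MvPolynomial σ ℂ →+* L)
    (hg : (maxIdeal p).map g = IsLocalRing.maximalIdeal L) (hgF : ∀ k, g (F k) = 0) :
    (IsLocalRing.maximalIdeal L).spanFinrank + Fintype.card ι ≤ Fintype.card σ := by
  set K := Submodule.span ℂ (Set.range fun k i => eval p (pderiv i (F k))) with hK
  obtain ⟨W, hW⟩ := K.exists_isCompl
  have hcard : Module.finrank ℂ K = Fintype.card ι := finrank_span_eq_card hF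
  have hadd := Submodule.finrank_add_eq_of_isCompl hW
  rw [hcard, Module.finrank_fintype_fun_eq_card] at hadd
  let b := Module.finBasis ℂ W
  set 𝔪 := IsLocalRing.maximalIdeal L
  let y : Fin (Module.finrank ℂ W) → L := fun j => g (linForm p (b j))
  have hmem {f : MvPolynomial σ ℂ} (hf : f ∈ maxIdeal p) : g f ∈ 𝔪 :=
    hg ▸ Ideal.mem_map_of_mem g hf
  set S : Ideal L := Ideal.span (Set.range y) ⊔ 𝔪 ^ 2 with hS
  -- The directions whose linear form lands in `S`; all of them do, since `K` and `W` do.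
  let N : Submodule ℂ (σ → ℂ) :=
    { carrier := {v | g (linForm p v) ∈ S}
      add_mem' := fun {a b} ha hb => by
        simp only [Set.mem_ofPred_eq, map_add] at *
        exact add_mem ha hb
      zero_mem' := by simp
      smul_mem' := fun c a ha => by
        simp only [Set.mem_ofPred_eq, map_smul, smul_eq_C_mul, map_mul] at *
        exact Ideal.mul_mem_left _ _ ha }
  have hKN : K ≤ N := by
    rw [hK, Submodule.span_le]
    rintro _ ⟨k, rfl⟩
    have h1 := Ideal.mem_map_of_mem g (taylor_mem p (F k))
    rw [Ideal.map_pow, hg, hFp] at h1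
    simp only [map_zero, sub_zero, map_sub, hgF, zero_sub, neg_mem_iff] at h1
    exact Ideal.mem_sup_right h1
  have hWN : W ≤ N := by
    intro w hw
    have h1 := b.sum_repr ⟨w, hw⟩
    have h2 : w = ∑ j, b.repr ⟨w, hw⟩ j • (b j : σ → ℂ) := by
      conv_lhs => rw [← Subtype.coe_mk (p := (· ∈ W)) w hw, ← h1]
      simp only [Submodule.coe_sum, Submodule.coe_smul]
    rw [h2]
    refine sum_mem fun j _ => N.smul_mem _ ?_
    exact Ideal.mem_sup_left (Ideal.subset_span ⟨j, rfl⟩)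
  have hN (v : σ → ℂ) : g (linForm p v) ∈ S :=
    (sup_le hKN hWN) (hW.sup_eq_top ▸ Submodule.mem_top : v ∈ K ⊔ W)
  have h𝔪S : 𝔪 ≤ Ideal.span (Set.range y) ⊔ 𝔪 • 𝔪 := by
    rw [smul_eq_mul, ← pow_two, ← hS, ← hg, Ideal.map_le_iff_le_comap]
    intro f hf
    have h1 := Ideal.mem_map_of_mem g (taylor_mem p f)
    rw [Ideal.map_pow, hg, RingHom.mem_ker.mp hf, map_zero, sub_zero, map_sub] at h1
    have h2 := add_mem (Ideal.mem_sup_right h1 : _ ∈ S) (hN fun i => eval p (pderiv i f))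
    simpa using h2
  have hle : 𝔪 ≤ Ideal.span (Set.range y) :=
    Submodule.le_of_le_smul_of_le_jacobson_bot (IsNoetherian.noetherian _)
      (IsLocalRing.maximalIdeal_le_jacobson _) h𝔪S
  have heq : 𝔪 = Ideal.span (Set.range y) :=
    hle.antisymm (Ideal.span_le.mpr (by rintro _ ⟨j, rfl⟩; exact hmem (linForm_mem p _)))
  have h3 : 𝔪.spanFinrank ≤ Module.finrank ℂ W := by
    rw [heq]
    refine (Submodule.spanFinrank_span_le_ncard_of_finite (Set.finite_range y)).trans ?_
    rw [← Set.image_univ]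
    exact (Set.ncard_image_le).trans (by simp [Set.ncard_univ])
  omega

variable {ι : Type*} [Fintype ι] {Z : Set (σ → ℂ)} {F : ι → MvPolynomial σ ℂ}

theorem comap_idealAt (p : Z) :
    (idealAt Z p).comap (Ideal.Quotient.mk (vanishingIdeal ℂ Z)) = maxIdeal p.1 := by
  ext f
  simp [idealAt, evalAt, RingHom.mem_ker, coe_aeval_eq_eval]

theorem map_maxIdeal (p : Z) :
    (maxIdeal p.1).map (Ideal.Quotient.mk (vanishingIdeal ℂ Z)) = idealAt Z p := by
  rw [← comap_idealAt, Ideal.map_comap_of_surjective _ Ideal.Quotient.mk_surjective]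

/-- A variety cut out by `m` equations has local dimension at least `dim - m` everywhere. If `s`
generates an ideal over which the maximal ideal of `p` in `ℂ[Z]` is minimal, then lifts of `s`
together with the equations do so in the polynomial ring, as each prime containing the equations
contains all polynomials vanishing on `Z`. -/
theorem card_le_height_idealAt_add [Fintype σ] (hZ : Z = {x | ∀ k, eval x (F k) = 0}) (p : Z) :
    (Fintype.card σ : ℕ∞) ≤ (idealAt Z p).height + Fintype.card ι := by
  classical
  obtain ⟨s, hs, hcard⟩ := (idealAt Z p).exists_finset_card_eq_height_of_isNoetherianRing
  choose lift hlift using Ideal.Quotient.mk_surjective (I := vanishingIdeal ℂ Z)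
  let T : Finset (MvPolynomial σ ℂ) := s.image lift ∪ Finset.univ.image F
  have hmax := maxIdeal_isMaximal p.1
  have hT : maxIdeal p.1 ∈ (Ideal.span (T : Set (MvPolynomial σ ℂ))).minimalPrimes := by
    refine ⟨⟨hmax.isPrime, ?_⟩, fun q hq hqp => ?_⟩
    · rw [Ideal.span_le]
      intro f hf
      simp only [T, Finset.coe_union, Finset.coe_image, Set.mem_union, Set.mem_image] at hf
      obtain ⟨a, ha, rfl⟩ | ⟨k, -, rfl⟩ := hf
      · rw [← comap_idealAt]
        simpa [hlift] using hs.1.2 (Ideal.subset_span ha)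
      · exact hZ.subset p.2 k
    · have := hq.1
      have hV : vanishingIdeal ℂ Z ≤ q := by
        have : Z = zeroLocus ℂ (Ideal.span (Set.range F)) := by
          rw [zeroLocus_span, hZ]
          simp
        rw [this, vanishingIdeal_zeroLocus_eq_radical]
        refine (hq.1.radical_le_iff).mpr (le_trans (Ideal.span_mono ?_) hq.2)
        rintro _ ⟨k, rfl⟩
        simp [T]
      have hq' : (q.map (Ideal.Quotient.mk (vanishingIdeal ℂ Z))).IsPrime :=
        Ideal.map_isPrime_of_surjective Ideal.Quotient.mk_surjective (by simpa using hV)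
      have h1 : idealAt Z p ≤ q.map (Ideal.Quotient.mk (vanishingIdeal ℂ Z)) := by
        refine hs.2 ⟨hq', Ideal.span_le.mpr fun a ha => ?_⟩ ?_
        · rw [← hlift a]
          exact Ideal.mem_map_of_mem _ (hq.2 (Ideal.subset_span (by
            simp only [T, Finset.coe_union, Finset.coe_image]
            exact Or.inl ⟨a, ha, rfl⟩)))
        · rw [← map_maxIdeal]
          exact Ideal.map_mono hqp
      have h2 := Ideal.comap_mono (f := Ideal.Quotient.mk (vanishingIdeal ℂ Z)) h1
      rwa [comap_idealAt, Ideal.comap_map_of_surjective _ Ideal.Quotient.mk_surjective,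
        ← RingHom.ker_eq_comap_bot, Ideal.mk_ker, sup_eq_left.mpr hV] at h2
  have h := Ideal.height_le_card_of_mem_minimalPrimes_span_finset hT
  rw [height_maxIdeal, Nat.card_eq_fintype_card] at h
  rw [← hcard]
  refine h.trans ?_
  have : T.card ≤ s.card + Fintype.card ι :=
    (Finset.card_union_le _ _).trans (add_le_add Finset.card_image_le Finset.card_image_le)
  exact_mod_cast this

/-- The **Jacobian criterion**: where the defining equations of `Z` have linearly independent
differentials, the local ring of `Z`, with its reduced structure, is regular of dimension
`dim - m`. The upper bound on the number of generators of its maximal ideal meets the lower bound on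
its dimension. -/
theorem isRegularLocalRing_localRingAt [Fintype σ] (hZ : Z = {x | ∀ k, eval x (F k) = 0}) (p : Z)
    (hF : LinearIndependent ℂ fun k i => eval p.1 (pderiv i (F k))) :
    IsRegularLocalRing (LocalRingAt Z p) ∧
      Fintype.card ι ≤ Fintype.card σ ∧
      ringKrullDim (LocalRingAt Z p) = (Fintype.card σ - Fintype.card ι : ℕ) := by
  have hp : ∀ k, eval p.1 (F k) = 0 := hZ.subset p.2
  have hN : IsNoetherianRing (LocalRingAt Z p) :=
    IsLocalization.isNoetherianRing (idealAt Z p).primeCompl _ inferInstance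
  have h1 := spanFinrank_maximalIdeal_add_card_le (L := LocalRingAt Z p) hF hp
    ((algebraMap (CoordRing Z) (LocalRingAt Z p)).comp (Ideal.Quotient.mk (vanishingIdeal ℂ Z)))
    (by rw [← Ideal.map_map (I := maxIdeal p.1), map_maxIdeal,
      Localization.AtPrime.map_eq_maximalIdeal])
    (fun k => by
      have : F k ∈ vanishingIdeal ℂ Z := fun x hx => hZ.subset hx k
      simp [Ideal.Quotient.eq_zero_iff_mem.mpr this])
  have h2 := card_le_height_idealAt_add hZ p
  have h3 := IsLocalization.AtPrime.ringKrullDim_eq_height (idealAt Z p) (LocalRingAt Z p)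
  have h4 := ringKrullDim_le_spanFinrank_maximalIdeal (R := LocalRingAt Z p)
  rw [h3] at h4
  obtain ⟨n, hn⟩ : ∃ n : ℕ, (idealAt Z p).height = n :=
    ⟨_, (ENat.natCast_toNat (ne_top_of_le_ne_top (ENat.natCast_ne_top _)
      (WithBot.coe_le_coe.mp h4))).symm⟩
  rw [hn] at h2 h3 h4
  have h2' : Fintype.card σ ≤ n + Fintype.card ι := by exact_mod_cast h2
  have h4' : n ≤ (IsLocalRing.maximalIdeal (LocalRingAt Z p)).spanFinrank := by exact_mod_cast h4
  have h5 : n = Fintype.card σ - Fintype.card ι := by omega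
  refine ⟨IsRegularLocalRing.of_spanFinrank_maximalIdeal_le _ ?_, by omega, ?_⟩
  · rw [h3]
    exact_mod_cast (by omega : _ ≤ n)
  · rw [h3, h5]
    rfl

/-- Vectors are linearly independent as soon as they are triangular with respect to a level
function: for each there is a linear form taking the value `1` on it and killing all the others of
at most its level. -/
theorem linearIndependent_of_triangular {ι σ : Type*} [Finite ι] [Fintype σ]
    (J : ι → σ → ℂ) (lvl : ι → ℕ)
    (h : ∀ k, ∃ v, v ⬝ᵥ J k = 1 ∧ ∀ k', k' ≠ k → lvl k' ≤ lvl k → v ⬝ᵥ J k' = 0) :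
    LinearIndependent ℂ J := by
  have := Fintype.ofFinite ι
  rw [Fintype.linearIndependent_iff]
  intro c hc
  by_contra! hne
  obtain ⟨k, hk, hmax⟩ := Set.exists_max_image {k | c k ≠ 0} lvl (Set.toFinite _) hne
  obtain ⟨v, hv1, hv⟩ := h k
  have h0 := congrArg (v ⬝ᵥ ·) hc
  simp only [dotProduct_sum, dotProduct_smul, dotProduct_zero] at h0
  rw [Finset.sum_eq_single k] at h0
  · exact hk (by simpa [hv1] using h0)
  · intro k' _ hk'
    by_cases hc' : c k' = 0
    · simp [hc']
    · simp [hv k' hk' (hmax k' hc')]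
  · simp

end Jacobian

end AffineVariety

/-! ### One-sided inverses of matrices -/

namespace Matrix

variable {m n : Type*} [Fintype n]

theorem exists_mul_eq_one_of_mulVec_injective [Fintype m] [DecidableEq m] [DecidableEq n]
    {A : Matrix m n ℂ}
    (h : Function.Injective A.mulVec) : ∃ N : Matrix n m ℂ, N * A = 1 := by
  obtain ⟨g, hg⟩ := (Matrix.toLin' A).exists_leftInverse_of_injective
    (LinearMap.ker_eq_bot.mpr h)
  refine ⟨LinearMap.toMatrix' g, ?_⟩
  rw [← LinearMap.toMatrix'_toLin' A, ← LinearMap.toMatrix'_comp, hg, LinearMap.toMatrix'_id]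

theorem mulVec_injective_of_det_mul_ne_zero [Fintype m] [DecidableEq n]
    {A : Matrix m n ℂ} {N : Matrix n m ℂ}
    (h : (N * A).det ≠ 0) : Function.Injective A.mulVec := by
  intro x y hxy
  refine mulVec_injective_of_det_ne_zero h ?_
  simp only [← mulVec_mulVec, hxy]

theorem mulVec_surjective_of_det_mul_ne_zero [Fintype m] [DecidableEq m]
    {A : Matrix m n ℂ} {N : Matrix n m ℂ}
    (h : (A * N).det ≠ 0) : Function.Surjective A.mulVec := by
  intro y
  obtain ⟨x, hx⟩ := mulVec_surjective_iff_isUnit.mpr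
    ((isUnit_iff_isUnit_det _).mpr (isUnit_iff_ne_zero.mpr h)) y
  exact ⟨N.mulVec x, by rw [mulVec_mulVec, hx]⟩

/-- Appending a column `u` to a matrix `A` with independent columns keeps the columns independent
exactly when `u` is not in the image of `A`. -/
theorem mulVec_injective_fromCols_iff {A : Matrix m n ℂ} {u : m → ℂ} :
    Function.Injective (fromCols A (replicateCol Unit u)).mulVec ↔
      Function.Injective A.mulVec ∧ u ∉ Set.range A.mulVec := by
  have key (x : n → ℂ) (c : ℂ) :
      (fromCols A (replicateCol Unit u)).mulVec (Sum.elim x fun _ => c) = A.mulVec x + c • u := by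
    rw [fromCols_mulVec_sumElim]
    congr 1
    ext i
    simp [mulVec, dotProduct, mul_comm]
  constructor
  · refine fun h => ⟨fun x y hxy => ?_, ?_⟩
    · have := @h (Sum.elim x fun _ => 0) (Sum.elim y fun _ => 0) (by simp only [key, hxy])
      exact funext fun i => congrFun this (Sum.inl i)
    · rintro ⟨x, hx⟩
      have := @h (Sum.elim x fun _ => 0) (Sum.elim 0 fun _ => 1) (by simp only [key, hx]; simp)
      simpa using congrFun this (Sum.inr ())
  · rintro ⟨hA, hu⟩
    refine (injective_iff_map_eq_zero (mulVecLin (fromCols A (replicateCol Unit u)))).mpr ?_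
    intro z hz
    obtain ⟨x, c, rfl⟩ : ∃ x c, z = Sum.elim x fun _ => c :=
      ⟨z ∘ Sum.inl, z (Sum.inr ()), by ext (i | i) <;> rfl⟩
    rw [mulVecLin_apply, key] at hz
    have hc : c = 0 := by
      by_contra hc
      refine hu ⟨-c⁻¹ • x, ?_⟩
      rw [mulVec_smul, eq_neg_of_add_eq_zero_left hz, smul_neg, neg_smul, neg_neg, smul_smul,
        inv_mul_cancel₀ hc, one_smul]
    subst hc
    have hx : x = 0 := hA (by simpa using hz)
    subst hx
    ext (i | i) <;> rfl

end Matrix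

/-! ### Zariski-open conditions -/

namespace AffineVariety

variable {σ : Type}

/-- `P` holds on a basic Zariski-open neighbourhood of `x`. -/
def HoldsNear (x : σ → ℂ) (P : (σ → ℂ) → Prop) : Prop :=
  ∃ f : MvPolynomial σ ℂ, eval x f ≠ 0 ∧ ∀ y, eval y f ≠ 0 → P y

theorem HoldsNear.mono {x : σ → ℂ} {P Q : (σ → ℂ) → Prop} (h : HoldsNear x P)
    (hPQ : ∀ y, P y → Q y) : HoldsNear x Q :=
  let ⟨f, hf, hP⟩ := h
  ⟨f, hf, fun y hy => hPQ y (hP y hy)⟩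

theorem HoldsNear.and {x : σ → ℂ} {P Q : (σ → ℂ) → Prop} (hP : HoldsNear x P)
    (hQ : HoldsNear x Q) : HoldsNear x fun y => P y ∧ Q y := by
  obtain ⟨f, hf, hfP⟩ := hP
  obtain ⟨g, hg, hgQ⟩ := hQ
  refine ⟨f * g, by simp [hf, hg], fun y hy => ?_⟩
  rw [map_mul, mul_ne_zero_iff] at hy
  exact ⟨hfP y hy.1, hgQ y hy.2⟩

theorem holdsNear_finset {ι : Type*} (s : Finset ι) {x : σ → ℂ} {P : ι → (σ → ℂ) → Prop}
    (h : ∀ i ∈ s, HoldsNear x (P i)) : HoldsNear x fun y => ∀ i ∈ s, P i y := by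
  classical
  choose! f hf hP using h
  refine ⟨∏ i ∈ s, f i, ?_, fun y hy i hi => hP i hi y ?_⟩
  · simpa [Finset.prod_ne_zero_iff] using hf
  · simp only [map_prod, Finset.prod_ne_zero_iff] at hy
    exact hy i hi

theorem isZariskiOpenIn_of_holdsNear {Z O : Set (σ → ℂ)} {P : (σ → ℂ) → Prop}
    (hO : O = {x | x ∈ Z ∧ P x}) (h : ∀ x ∈ O, HoldsNear x P) : IsZariskiOpenIn Z O := by
  refine ⟨Ideal.span {f | ∀ y, eval y f ≠ 0 → P y}, ?_⟩
  ext x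
  simp only [zeroLocus_span, Set.mem_sdiff, Set.mem_ofPred_eq, not_forall]
  constructor
  · intro hx
    obtain ⟨f, hf, hP⟩ := h x hx
    rw [hO] at hx
    exact ⟨hx.1, f, hP, hf⟩
  · rintro ⟨hxZ, f, hf, hfx⟩
    rw [hO]
    exact ⟨hxZ, hf x hfx⟩

variable {m n : Type*} [Fintype m] [Fintype n]

theorem eval_det_map [DecidableEq n] (x : σ → ℂ) (G : Matrix n n (MvPolynomial σ ℂ)) :
    eval x G.det = (G.map (eval x)).det := by
  rw [RingHom.map_det, RingHom.mapMatrix_apply]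

/-- If `N` is a left inverse of `G(x)`, then `G` is injective wherever `det (N G) ≠ 0`. -/
theorem holdsNear_injective [DecidableEq m] [DecidableEq n] {x : σ → ℂ}
    (G : Matrix m n (MvPolynomial σ ℂ))
    (h : Function.Injective (G.map (eval x)).mulVec) :
    HoldsNear x fun y => Function.Injective (G.map (eval y)).mulVec := by
  obtain ⟨N, hN⟩ := Matrix.exists_mul_eq_one_of_mulVec_injective h
  have key (y : σ → ℂ) : eval y (N.map (C (σ := σ)) * G).det = (N * G.map (eval y)).det := by
    rw [eval_det_map, Matrix.map_mul, Matrix.map_map]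
    congr
    ext
    simp
  refine ⟨(N.map (C (σ := σ)) * G).det, by simp [key, hN], fun y hy => ?_⟩
  exact Matrix.mulVec_injective_of_det_mul_ne_zero (key y ▸ hy)

theorem holdsNear_surjective [DecidableEq m] {x : σ → ℂ} (G : Matrix m n (MvPolynomial σ ℂ))
    (h : Function.Surjective (G.map (eval x)).mulVec) :
    HoldsNear x fun y => Function.Surjective (G.map (eval y)).mulVec := by
  obtain ⟨N, hN⟩ := Matrix.mulVec_surjective_iff_exists_right_inverse.mp h
  have key (y : σ → ℂ) : eval y (G * N.map (C (σ := σ))).det = (G.map (eval y) * N).det := by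
    rw [eval_det_map, Matrix.map_mul, Matrix.map_map]
    congr
    ext
    simp
  refine ⟨(G * N.map (C (σ := σ))).det, by simp [key, hN], fun y hy => ?_⟩
  exact Matrix.mulVec_surjective_of_det_mul_ne_zero (key y ▸ hy)

end AffineVariety

namespace EnhancedQuiver

variable {t : ℕ} {r : Fin t → ℕ}

/-! ### The conditions defining `Λ°` are open -/

/-- The vector of the coordinate functions of `u_i`. -/
def genU (r : Fin t → ℕ) (i : ℕ) (hi : i < t + 1) : Fin (dimU r i) → MvPolynomial (Coord r) ℂ :=
  fun a => X (Sum.inl ⟨⟨i, hi⟩, a⟩)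

/-- The matrix of the coordinate functions of `A_i`. -/
def genA (r : Fin t → ℕ) (i : ℕ) (hi : i < t) :
    Matrix (Fin (dimU r (i + 1))) (Fin (dimU r i)) (MvPolynomial (Coord r) ℂ) :=
  Matrix.of fun a b => X (Sum.inr (Sum.inl ⟨⟨i, hi⟩, (a, b)⟩))

/-- The matrix of the coordinate functions of `B_i`. -/
def genB (r : Fin t → ℕ) (i : ℕ) (hi : i < t) :
    Matrix (Fin (dimU r i)) (Fin (dimU r (i + 1))) (MvPolynomial (Coord r) ℂ) :=
  Matrix.of fun a b => X (Sum.inr (Sum.inr ⟨⟨i, hi⟩, (a, b)⟩))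

@[simp]
theorem eval_genU (x : Coord r → ℂ) (i : ℕ) (hi : i < t + 1) (a : Fin (dimU r i)) :
    eval x (genU r i hi a) = vecU x i hi a := by
  simp [genU, vecU]

@[simp]
theorem eval_genA (x : Coord r → ℂ) (i : ℕ) (hi : i < t) (a b) :
    eval x (genA r i hi a b) = matA x i hi a b := by
  simp [genA, matA]

@[simp]
theorem eval_genB (x : Coord r → ℂ) (i : ℕ) (hi : i < t) (a b) :
    eval x (genB r i hi a b) = matB x i hi a b := by
  simp [genB, matB]

theorem genA_map (x : Coord r → ℂ) (i : ℕ) (hi : i < t) :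
    (genA r i hi).map (eval x) = matA x i hi := by
  ext; simp

theorem genB_map (x : Coord r → ℂ) (i : ℕ) (hi : i < t) :
    (genB r i hi).map (eval x) = matB x i hi := by
  ext; simp

theorem fromCols_gen_map (x : Coord r → ℂ) (i : ℕ) (hi : i < t) :
    (Matrix.fromCols (genA r i hi)
        (Matrix.replicateCol Unit (genU r (i + 1) (Nat.succ_lt_succ hi)))).map (eval x) =
      Matrix.fromCols (matA x i hi)
        (Matrix.replicateCol Unit (vecU x (i + 1) (Nat.succ_lt_succ hi))) := by
  ext a (b | b) <;> simp

theorem isZariskiOpenIn_circ (I : Finset (Fin t)) :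
    AffineVariety.IsZariskiOpenIn (enhancedVariety r I) (enhancedVarietyCirc r I) := by
  refine AffineVariety.isZariskiOpenIn_of_holdsNear rfl fun x hx => ?_
  obtain ⟨-, hI, hI'⟩ := hx
  have hB (j : Fin t) (h : Function.Surjective (matB x j j.2).mulVec) :
      AffineVariety.HoldsNear x fun y => Function.Surjective (matB y j j.2).mulVec := by
    simpa only [genB_map] using AffineVariety.holdsNear_surjective (x := x) (genB r j j.2)
      (by rwa [genB_map])
  have h1 := AffineVariety.holdsNear_finset I (x := x) (P := fun j y =>
      (Function.Injective (matA y j j.2).mulVec ∧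
        vecU y (j + 1) (Nat.succ_lt_succ j.2) ∉ Set.range (matA y j j.2).mulVec) ∨
      Function.Surjective (matB y j j.2).mulVec) fun j hj => by
    rcases hI j hj with h | h
    · rw [← Matrix.mulVec_injective_fromCols_iff, ← fromCols_gen_map] at h
      refine (AffineVariety.holdsNear_injective _ h).mono fun y hy => Or.inl ?_
      rwa [fromCols_gen_map, Matrix.mulVec_injective_fromCols_iff] at hy
    · exact (hB j h).mono fun y => Or.inr
  have h2 := AffineVariety.holdsNear_finset Iᶜ (x := x) (P := fun j y =>
      Function.Injective (matA y j j.2).mulVec ∨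
      Function.Surjective (matB y j j.2).mulVec) fun j hj => by
    rcases hI' j (Finset.mem_compl.mp hj) with h | h
    · rw [← genA_map] at h
      refine (AffineVariety.holdsNear_injective _ h).mono fun y hy => Or.inl ?_
      rwa [genA_map] at hy
    · exact (hB j h).mono fun y => Or.inr
  exact (h1.and h2).mono fun y hy => ⟨hy.1, fun j hj => hy.2 j (Finset.mem_compl.mpr hj)⟩

/-! ### A point of `Λ°` -/

theorem dimU_le_succ (r : Fin t → ℕ) (i : ℕ) : dimU r i ≤ dimU r (i + 1) :=
  Finset.sum_le_sum_of_subset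
    (Finset.monotone_filter_right _ fun k _ hk =>
      (show (k : ℕ) < i + 1 from hk.trans i.lt_succ_self))

/-- With all `u_i` and `A_i` zero the equations hold whatever the `B_i` are; the coordinate
projections `U_{i+1} → U_i` are surjective. -/
theorem circ_nonempty (r : Fin t → ℕ) (I : Finset (Fin t)) : (enhancedVarietyCirc r I).Nonempty := by
  let x : Coord r → ℂ := Sum.elim 0 (Sum.elim 0 fun s =>
    if (s.2.1 : ℕ) = (s.2.2 : ℕ) then 1 else 0)
  have hU (i : ℕ) (hi : i < t + 1) : vecU x i hi = 0 := rfl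
  have hA (i : ℕ) (hi : i < t) : matA x i hi = 0 := rfl
  have hB (i : ℕ) (hi : i < t) : Function.Surjective (matB x i hi).mulVec := by
    intro y
    refine ⟨fun b => if h : (b : ℕ) < dimU r i then y ⟨b, h⟩ else 0, ?_⟩
    ext a
    rw [Matrix.mulVec, dotProduct, Finset.sum_eq_single (Fin.castLE (dimU_le_succ r i) a)]
    · simp [matB, x]
    · intro b _ hb
      have : (a : ℕ) ≠ (b : ℕ) := fun h => hb (Fin.ext h.symm)
      simp [matB, x, this]
    · simp
  refine ⟨x, ⟨?_, ?_, ?_⟩, fun j _ => Or.inr (hB j j.2), fun j _ => Or.inr (hB j j.2)⟩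
  · intro i hi
    simp [hA]
  · intro i _
    simp [hU]
  · intro i _
    simp [hU, hA]

/-! ### The equations of `Λ` and their differentials -/

/-- The index set of the equations of `Λ`: the entries of `B_{i+1} A_{i+1} - A_i B_i` for
`i + 1 < t`, of `B_i u_{i+1} - u_i` for `i ∈ I`, and of `A_i u_i - u_{i+1}` for `i ∉ I`. -/
abbrev EqIdx (r : Fin t → ℕ) (I : Finset (Fin t)) : Type :=
  (Σ i : Fin (t - 1), Fin (dimU r (i + 1)) × Fin (dimU r (i + 1))) ⊕
    ((Σ i : I, Fin (dimU r i)) ⊕ (Σ i : (Iᶜ : Finset (Fin t)), Fin (dimU r (i + 1))))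

theorem succ_lt_of_fin (i : Fin (t - 1)) : (i : ℕ) + 1 < t := by omega

/-- The equations of `Λ`. -/
def equation (r : Fin t → ℕ) (I : Finset (Fin t)) : EqIdx r I → MvPolynomial (Coord r) ℂ
  | Sum.inl ⟨i, a, b⟩ =>
    (genB r (i + 1) (succ_lt_of_fin i) * genA r (i + 1) (succ_lt_of_fin i)
      - genA r i (Nat.lt_of_succ_lt (succ_lt_of_fin i))
        * genB r i (Nat.lt_of_succ_lt (succ_lt_of_fin i))) a b
  | Sum.inr (Sum.inl ⟨i, a⟩) =>
    ((genB r i i.1.2).mulVec (genU r (i + 1) (Nat.succ_lt_succ i.1.2))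
      - genU r i (Nat.lt_succ_of_lt i.1.2)) a
  | Sum.inr (Sum.inr ⟨i, a⟩) =>
    ((genA r i i.1.2).mulVec (genU r i (Nat.lt_succ_of_lt i.1.2))
      - genU r (i + 1) (Nat.succ_lt_succ i.1.2)) a

theorem enhancedVariety_eq (r : Fin t → ℕ) (I : Finset (Fin t)) :
    enhancedVariety r I = {x | ∀ k, eval x (equation r I k) = 0} := by
  ext x
  simp only [enhancedVariety, Set.mem_ofPred_eq, Sum.forall, Sigma.forall, Prod.forall,
    Subtype.forall, Finset.mem_compl, equation]
  refine and_congr ⟨fun h i a b => ?_, fun h i hi => ?_⟩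
    (and_congr (forall₂_congr fun i hi => ?_) (forall₂_congr fun i hi => ?_))
  · have := congrFun (congrFun (h i (succ_lt_of_fin i)) a) b
    simpa [Matrix.mul_apply, sub_eq_zero] using this
  · ext a b
    have := h ⟨i, by omega⟩ a b
    simpa [Matrix.mul_apply, sub_eq_zero] using this
  · simp [funext_iff, Matrix.mulVec, dotProduct, sub_eq_zero]
  · simp [funext_iff, Matrix.mulVec, dotProduct, sub_eq_zero]

open AffineVariety

@[simp]
theorem dirDeriv_genU (p v : Coord r → ℂ) (i : ℕ) (hi : i < t + 1) (a : Fin (dimU r i)) :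
    dirDeriv p v (genU r i hi a) = vecU v i hi a := by
  simp [genU, vecU]

@[simp]
theorem dirDeriv_genA (p v : Coord r → ℂ) (i : ℕ) (hi : i < t) (a b) :
    dirDeriv p v (genA r i hi a b) = matA v i hi a b := by
  simp [genA, matA]

@[simp]
theorem dirDeriv_genB (p v : Coord r → ℂ) (i : ℕ) (hi : i < t) (a b) :
    dirDeriv p v (genB r i hi a b) = matB v i hi a b := by
  simp [genB, matB]

theorem dirDeriv_comm (I : Finset (Fin t)) (p v : Coord r → ℂ) (i : Fin (t - 1)) (a b) :
    dirDeriv p v (equation r I (Sum.inl ⟨i, a, b⟩)) =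
      (matB v (i + 1) (succ_lt_of_fin i) * matA p (i + 1) (succ_lt_of_fin i)
        + matB p (i + 1) (succ_lt_of_fin i) * matA v (i + 1) (succ_lt_of_fin i)
        - (matA v i (Nat.lt_of_succ_lt (succ_lt_of_fin i))
            * matB p i (Nat.lt_of_succ_lt (succ_lt_of_fin i))
          + matA p i (Nat.lt_of_succ_lt (succ_lt_of_fin i))
            * matB v i (Nat.lt_of_succ_lt (succ_lt_of_fin i)))) a b := by
  simp [equation, Matrix.mul_apply, Finset.sum_add_distrib]

theorem dirDeriv_mem (I : Finset (Fin t)) (p v : Coord r → ℂ) (i : I) (a) :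
    dirDeriv p v (equation r I (Sum.inr (Sum.inl ⟨i, a⟩))) =
      ((matB v i i.1.2).mulVec (vecU p (i + 1) (Nat.succ_lt_succ i.1.2))
        + (matB p i i.1.2).mulVec (vecU v (i + 1) (Nat.succ_lt_succ i.1.2))
        - vecU v i (Nat.lt_succ_of_lt i.1.2)) a := by
  simp [equation, Matrix.mulVec, dotProduct, Finset.sum_add_distrib]

theorem dirDeriv_compl (I : Finset (Fin t)) (p v : Coord r → ℂ) (i : (Iᶜ : Finset (Fin t))) (a) :
    dirDeriv p v (equation r I (Sum.inr (Sum.inr ⟨i, a⟩))) =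
      ((matA v i i.1.2).mulVec (vecU p i (Nat.lt_succ_of_lt i.1.2))
        + (matA p i i.1.2).mulVec (vecU v i (Nat.lt_succ_of_lt i.1.2))
        - vecU v (i + 1) (Nat.succ_lt_succ i.1.2)) a := by
  simp [equation, Matrix.mulVec, dotProduct, Finset.sum_add_distrib]

/-! ### Triangularity of the differentials on `Λ°` -/

/-- The tangent vector whose only nonzero components are `A_j = α`, `B_j = β` and `u_{j+1} = w`. -/
def levelVec (j : Fin t) (α : Matrix (Fin (dimU r (j + 1))) (Fin (dimU r j)) ℂ)
    (β : Matrix (Fin (dimU r j)) (Fin (dimU r (j + 1))) ℂ) (w : Fin (dimU r (j + 1)) → ℂ) :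
    Coord r → ℂ :=
  Sum.elim
    (fun s => (Pi.single j.succ w : ∀ i : Fin (t + 1), Fin (dimU r i) → ℂ) s.1 s.2)
    (Sum.elim
      (fun s => (Pi.single j α :
        ∀ i : Fin t, Matrix (Fin (dimU r (i + 1))) (Fin (dimU r i)) ℂ) s.1 s.2.1 s.2.2)
      (fun s => (Pi.single j β :
        ∀ i : Fin t, Matrix (Fin (dimU r i)) (Fin (dimU r (i + 1))) ℂ) s.1 s.2.1 s.2.2))

section levelVec

variable (j : Fin t) (α : Matrix (Fin (dimU r (j + 1))) (Fin (dimU r j)) ℂ)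
  (β : Matrix (Fin (dimU r j)) (Fin (dimU r (j + 1))) ℂ) (w : Fin (dimU r (j + 1)) → ℂ)

@[simp]
theorem matA_levelVec_self : matA (levelVec j α β w) j j.2 = α := by
  ext a b
  simp [matA, levelVec]

@[simp]
theorem matB_levelVec_self : matB (levelVec j α β w) j j.2 = β := by
  ext a b
  simp [matB, levelVec]

@[simp]
theorem vecU_levelVec_self :
    vecU (levelVec j α β w) (j + 1) (Nat.succ_lt_succ j.2) = w := by
  ext a
  exact congrFun (Pi.single_eq_same (M := fun i : Fin (t + 1) => Fin (dimU r i) → ℂ) j.succ w) a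

variable {j}

theorem matA_levelVec_of_ne {i : ℕ} (hi : i < t) (h : i ≠ j) :
    matA (levelVec j α β w) i hi = 0 := by
  ext a b
  have : (⟨i, hi⟩ : Fin t) ≠ j := fun e => h (congrArg Fin.val e)
  simp [matA, levelVec, Pi.single_eq_of_ne this]

theorem matB_levelVec_of_ne {i : ℕ} (hi : i < t) (h : i ≠ j) :
    matB (levelVec j α β w) i hi = 0 := by
  ext a b
  have : (⟨i, hi⟩ : Fin t) ≠ j := fun e => h (congrArg Fin.val e)
  simp [matB, levelVec, Pi.single_eq_of_ne this]

theorem vecU_levelVec_of_ne {i : ℕ} (hi : i < t + 1) (h : i ≠ j + 1) :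
    vecU (levelVec j α β w) i hi = 0 := by
  ext a
  have : (⟨i, hi⟩ : Fin (t + 1)) ≠ j.succ := fun e => h (congrArg Fin.val e)
  simp [vecU, levelVec, Pi.single_eq_of_ne this]

end levelVec

/-- The linear algebra behind the definition of `Λ°`: its condition at `j` makes the differential of
the equations of level `j`, restricted to the variables `A_j`, `B_j`, `u_{j+1}`, surjective. -/
theorem exists_level_preimage {I : Finset (Fin t)} {p : Coord r → ℂ}
    (hp : p ∈ enhancedVarietyCirc r I) (j : Fin t)
    (E : Matrix (Fin (dimU r j)) (Fin (dimU r j)) ℂ) (y : Fin (dimU r j) → ℂ)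
    (z : Fin (dimU r (j + 1)) → ℂ) :
    ∃ (α : Matrix (Fin (dimU r (j + 1))) (Fin (dimU r j)) ℂ)
      (β : Matrix (Fin (dimU r j)) (Fin (dimU r (j + 1))) ℂ) (w : Fin (dimU r (j + 1)) → ℂ),
      β * matA p j j.2 + matB p j j.2 * α = E ∧
      (j ∈ I → β.mulVec (vecU p (j + 1) (Nat.succ_lt_succ j.2)) + (matB p j j.2).mulVec w = y) ∧
      (j ∉ I → α.mulVec (vecU p j (Nat.lt_succ_of_lt j.2)) - w = z) := by
  obtain ⟨-, hI, hI'⟩ := hp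
  by_cases hj : j ∈ I
  · rcases hI j hj with h | h
    · -- A left inverse of the columns of `A_j` and `u_{j+1}` prescribes `β` on all of them.
      obtain ⟨N, hN⟩ := Matrix.exists_mul_eq_one_of_mulVec_injective
        (Matrix.mulVec_injective_fromCols_iff.mpr h)
      have key := congrArg (Matrix.fromCols E (Matrix.replicateCol Unit y) * ·) hN
      simp only [← Matrix.mul_assoc, Matrix.mul_one] at key
      rw [Matrix.mul_fromCols] at key
      replace key := Matrix.fromCols_inj key
      refine ⟨0, Matrix.fromCols E (Matrix.replicateCol Unit y) * N, 0, ?_, fun _ => ?_,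
        fun h => absurd hj h⟩
      · simpa using key.1
      · ext a
        have := congrFun (congrFun key.2 a) ()
        simpa [Matrix.mul_apply, Matrix.mulVec, dotProduct] using this
    · obtain ⟨N, hN⟩ := Matrix.mulVec_surjective_iff_exists_right_inverse.mp h
      refine ⟨N * E, 0, N.mulVec y, ?_, fun _ => ?_, fun h => absurd hj h⟩
      · rw [← Matrix.mul_assoc, hN]
        simp
      · simp [hN]
  · rcases hI' j hj with h | h
    · obtain ⟨N, hN⟩ := Matrix.exists_mul_eq_one_of_mulVec_injective h
      refine ⟨0, E * N, -z, ?_, fun h => absurd h hj, fun _ => ?_⟩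
      · simp [Matrix.mul_assoc, hN]
      · simp
    · obtain ⟨N, hN⟩ := Matrix.mulVec_surjective_iff_exists_right_inverse.mp h
      refine ⟨N * E, 0, (N * E).mulVec (vecU p j (Nat.lt_succ_of_lt j.2)) - z, ?_,
        fun h => absurd h hj, fun _ => ?_⟩
      · rw [← Matrix.mul_assoc, hN]
        simp
      · simp

/-- The level of an equation: the largest `j` such that it involves `A_j` or `B_j`. -/
def level (r : Fin t → ℕ) (I : Finset (Fin t)) : EqIdx r I → ℕ
  | Sum.inl s => s.1 + 1
  | Sum.inr (Sum.inl s) => s.1.1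
  | Sum.inr (Sum.inr s) => s.1.1

/-- At a point of `Λ°`, the differentials of the equations of level `j` take arbitrary prescribed
values on a vector that is killed by those of lower level. -/
theorem exists_dirDeriv_eq {I : Finset (Fin t)} {p : Coord r → ℂ}
    (hp : p ∈ enhancedVarietyCirc r I) (j : ℕ) (hj : j < t) (c : EqIdx r I → ℂ) :
    ∃ v, (∀ k, level r I k = j → dirDeriv p v (equation r I k) = c k) ∧
      ∀ k, level r I k < j → dirDeriv p v (equation r I k) = 0 := by
  let E : Matrix (Fin (dimU r j)) (Fin (dimU r j)) ℂ :=
    match j, hj with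
    | 0, _ => 0
    | i + 1, hi => Matrix.of fun a b => c (Sum.inl ⟨⟨i, by omega⟩, a, b⟩)
  obtain ⟨α, β, w, h1, h2, h3⟩ := exists_level_preimage hp ⟨j, hj⟩ E
    (fun a => if h : (⟨j, hj⟩ : Fin t) ∈ I then c (Sum.inr (Sum.inl ⟨⟨⟨j, hj⟩, h⟩, a⟩)) else 0)
    (fun a => if h : (⟨j, hj⟩ : Fin t) ∈ Iᶜ then c (Sum.inr (Sum.inr ⟨⟨⟨j, hj⟩, h⟩, a⟩)) else 0)
  refine ⟨levelVec ⟨j, hj⟩ α β w, ?_, ?_⟩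
  · rintro (⟨i, a, b⟩ | ⟨⟨i, hi⟩, a⟩ | ⟨⟨i, hi⟩, a⟩) hk
    · obtain rfl : (i : ℕ) + 1 = j := hk
      rw [dirDeriv_comm, matA_levelVec_of_ne (i := i) _ _ _ _ (by simp),
        matB_levelVec_of_ne (i := i) _ _ _ _ (by simp)]
      have hA := matA_levelVec_self ⟨i + 1, hj⟩ α β w
      have hB := matB_levelVec_self ⟨i + 1, hj⟩ α β w
      simp only at hA hB
      rw [hA, hB]
      simp only [Matrix.zero_mul, Matrix.mul_zero, add_zero, sub_zero]
      exact congrFun (congrFun h1 a) b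
    · obtain rfl : (i : ℕ) = j := hk
      rw [dirDeriv_mem, vecU_levelVec_of_ne (i := i) _ _ _ _ (by simp)]
      have hB := matB_levelVec_self i α β w
      have hU := vecU_levelVec_self i α β w
      simp only [Fin.eta, hB, hU, sub_zero]
      refine (congrFun (h2 hi) a).trans ?_
      simp [hi]
    · obtain rfl : (i : ℕ) = j := hk
      rw [dirDeriv_compl, vecU_levelVec_of_ne (i := i) _ _ _ _ (by simp)]
      have hA := matA_levelVec_self i α β w
      have hU := vecU_levelVec_self i α β w
      simp only [Fin.eta, hA, hU, Matrix.mulVec_zero, add_zero]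
      refine (congrFun (h3 (Finset.mem_compl.mp hi)) a).trans ?_
      simp only [Fin.eta, hi, dite_true]
  · rintro (⟨i, a, b⟩ | ⟨⟨i, hi⟩, a⟩ | ⟨⟨i, hi⟩, a⟩) hk
    · have hk : (i : ℕ) + 1 < j := hk
      rw [dirDeriv_comm, matA_levelVec_of_ne (i := i) _ _ _ _ (by simp; omega),
        matB_levelVec_of_ne (i := i) _ _ _ _ (by simp; omega),
        matA_levelVec_of_ne (i := i + 1) _ _ _ _ (by simp; omega),
        matB_levelVec_of_ne (i := i + 1) _ _ _ _ (by simp; omega)]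
      simp
    · have hk : (i : ℕ) < j := hk
      rw [dirDeriv_mem, vecU_levelVec_of_ne (i := i) _ _ _ _ (by simp; omega),
        vecU_levelVec_of_ne (i := i + 1) _ _ _ _ (by simp; omega),
        matB_levelVec_of_ne (i := i) _ _ _ _ (by simp; omega)]
      simp
    · have hk : (i : ℕ) < j := hk
      rw [dirDeriv_compl, vecU_levelVec_of_ne (i := i) _ _ _ _ (by simp; omega),
        vecU_levelVec_of_ne (i := i + 1) _ _ _ _ (by simp; omega),
        matA_levelVec_of_ne (i := i) _ _ _ _ (by simp; omega)]
      simp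

theorem level_lt (I : Finset (Fin t)) (k : EqIdx r I) : level r I k < t := by
  obtain ⟨i, _⟩ | ⟨i, _⟩ | ⟨i, _⟩ := k
  · exact succ_lt_of_fin i
  · exact i.1.2
  · exact i.1.2

theorem linearIndependent_differentials {I : Finset (Fin t)} {p : Coord r → ℂ}
    (hp : p ∈ enhancedVarietyCirc r I) :
    LinearIndependent ℂ fun k i => eval p (pderiv i (equation r I k)) := by
  classical
  refine linearIndependent_of_triangular _ (level r I) fun k => ?_
  obtain ⟨v, hv, hv'⟩ := exists_dirDeriv_eq hp (level r I k) (level_lt I k) (Pi.single k 1)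
  simp only [dirDeriv_apply] at hv hv'
  refine ⟨v, (hv k rfl).trans (Pi.single_eq_same k 1), fun k' hk' hle => ?_⟩
  rcases hle.eq_or_lt with h | h
  · exact (hv k' h).trans (Pi.single_eq_of_ne hk' 1)
  · exact hv' k' h

theorem card_coord_sub_card_eqIdx (r : Fin t → ℕ) (I : Finset (Fin t)) :
    (Fintype.card (Coord r) : ℤ) - Fintype.card (EqIdx r I) = expectedDim r I := by
  have h1 : ∑ i : Fin (t - 1), dimU r (i + 1) * dimU r (i + 1) =
      ∑ i ∈ Finset.Ico 1 t, dimU r i ^ 2 := by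
    rw [Finset.sum_Ico_eq_sum_range, ← Fin.sum_univ_eq_sum_range (fun i => dimU r (1 + i) ^ 2)]
    exact Finset.sum_congr rfl fun i _ => by rw [add_comm, pow_two]
  have h2 : ∑ i : Fin t, dimU r (i + 1) * dimU r i =
      ∑ i ∈ Finset.range t, dimU r i * dimU r (i + 1) := by
    rw [← Fin.sum_univ_eq_sum_range fun i => dimU r i * dimU r (i + 1)]
    exact Finset.sum_congr rfl fun i _ => mul_comm _ _
  simp only [Coord, EqIdx, Fintype.card_sum, Fintype.card_sigma, Fintype.card_prod,
    Fintype.card_fin, expectedDim, h1, h2,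
    Fin.sum_univ_eq_sum_range fun i => dimU r i * dimU r (i + 1),
    Fin.sum_univ_eq_sum_range fun i => dimU r i,
    Finset.sum_coe_sort I fun i => dimU r i, Finset.sum_coe_sort Iᶜ fun i => dimU r (i + 1)]
  push_cast
  ring

end EnhancedQuiver

end

theorem proposition5p1 (t : ℕ) (ht : 0 < t) (r : Fin t → ℕ) (hr_pos : ∀ i, 0 < r i)
    (hr_mono : Monotone r) (I : Finset (Fin t))
    (hI : ∀ i j : Fin t, (j : ℕ) = (i : ℕ) + 1 → r i = r j → j ∈ I → i ∈ I) :
    AffineVariety.IsZariskiOpenIn (EnhancedQuiver.enhancedVariety r I)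
        (EnhancedQuiver.enhancedVarietyCirc r I) ∧
      (EnhancedQuiver.enhancedVarietyCirc r I).Nonempty ∧
      ∃ d : ℕ, (d : ℤ) = EnhancedQuiver.expectedDim r I ∧
        ∀ p : EnhancedQuiver.enhancedVariety r I,
          p.1 ∈ EnhancedQuiver.enhancedVarietyCirc r I →
            IsRegularLocalRing
                (AffineVariety.LocalRingAt (EnhancedQuiver.enhancedVariety r I) p) ∧
              ringKrullDim
                (AffineVariety.LocalRingAt (EnhancedQuiver.enhancedVariety r I) p) = d := by
  have key (p : EnhancedQuiver.enhancedVariety r I)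
      (hp : p.1 ∈ EnhancedQuiver.enhancedVarietyCirc r I) :=
    AffineVariety.isRegularLocalRing_localRingAt (EnhancedQuiver.enhancedVariety_eq r I) p
      (EnhancedQuiver.linearIndependent_differentials hp)
  obtain ⟨x, hx⟩ := EnhancedQuiver.circ_nonempty r I
  refine ⟨EnhancedQuiver.isZariskiOpenIn_circ I, ⟨x, hx⟩, _, ?_,
    fun p hp => ⟨(key p hp).1, (key p hp).2.2⟩⟩
  rw [Nat.cast_sub (key ⟨x, hx.1⟩ hx).2.1, EnhancedQuiver.card_coord_sub_card_eqIdx]
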